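/- Let $p$ be an odd prime and let $D_{2p}$ be the dihedral group of order $2p$. For a subset $S\subseteq D_{2p}$ not containing the identity, the Cayley digraph $\mathrm{Cay}(D_{2p},S)$ has vertex set $D_{2p}$ and an arc from $g$ to $h$ if and only if $hg^{-1}\in S$. Then the number of Cayley digraphs on $D_{2p}$, counted up to isomorphism of digraphs, is $$\mathcal{N}=\frac{1}{p}\,2^{p}\left(1-2^{p-1}\right)+\frac{2}{p-1}\sum_{d\mid (p-1)}\varphi(d)\,2^{\frac{2(p-1)}{d}},$$ where the sum runs over the positive divisors $d$ of $p-1$ and $\varphi$ is Euler's totient function. -/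

import Mathlib

/-- The Cayley digraph `Cay(G, S)`: the vertices are the elements of `G`, and there is an arc
from `g` to `h` exactly when `h * g⁻¹ ∈ S`. -/
def cayleyDigraph {G : Type*} [Group G] (S : Set G) : Digraph G where
  Adj g h := h * g⁻¹ ∈ S

/-- A digraph with vertex set `G` is a Cayley digraph on `G` if it is `Cay(G, S)` for some subset
`S` of `G` that does not contain the identity. -/
def IsCayleyDigraph {G : Type*} [Group G] (Γ : Digraph G) : Prop :=
  ∃ S : Set G, (1 : G) ∉ S ∧ Γ = cayleyDigraph S

/-- Two digraphs are isomorphic if some bijection of the vertices preserves arcs in both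
directions. -/
def DigraphIsomorphic {V W : Type*} (Γ : Digraph V) (Δ : Digraph W) : Prop :=
  Nonempty (Γ.Adj ≃r Δ.Adj)

/-- Isomorphism of digraphs, as an equivalence relation on the Cayley digraphs on `G`. -/
def cayleyDigraphIsoSetoid (G : Type*) [Group G] :
    Setoid {Γ : Digraph G // IsCayleyDigraph Γ} where
  r Γ Δ := DigraphIsomorphic Γ.1 Δ.1
  iseqv :=
    { refl := fun Γ => ⟨RelIso.refl Γ.1.Adj⟩
      symm := fun ⟨f⟩ => ⟨f.symm⟩
      trans := fun ⟨f⟩ ⟨g⟩ => ⟨f.trans g⟩ }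

/-- The number of Cayley digraphs on `G` up to isomorphism of digraphs. -/
noncomputable def numCayleyDigraphs (G : Type*) [Group G] : ℕ :=
  Nat.card (Quotient (cayleyDigraphIsoSetoid G))

/-! Babai's Sylow argument followed by Burnside. As `p ^ 3` does not divide `(2 * p)!`, a Sylow
`p`-subgroup of the automorphism group of a Cayley digraph is abelian. So an isomorphism `f`,
corrected by an automorphism and a right translation, fixes `1` and conjugates the shift into its
own centralizer. It is then affine on each coset of the rotations, and `exists_affine_of_cayley_iso`
extracts a group automorphism carrying `S` to `T`. Isomorphism classes thus become orbits of the
affine group on pairs (set of units, set of residues). With `d = orderOf u`, the map `(u, c)` fixes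
`2 * 2 ^ (2 * (p - 1) / d)` pairs if `u ≠ 1`; for `u = 1` the identity and the other translations
are counted separately. -/

open scoped Pointwise

/-! ### Sylow subgroups of order at most `p ^ 2` -/

/-- If `p ^ 3` does not divide the order of a finite group, then any two elements of order `p`
commute up to conjugation. -/
lemma exists_commute_conj_of_not_dvd {G : Type*} [Group G] [Finite G] {p : ℕ} [hp : Fact p.Prime]
    (h : ¬ p ^ 3 ∣ Nat.card G) {x y : G} (hx : orderOf x = p) (hy : orderOf y = p) :
    ∃ g : G, Commute x (g * y * g⁻¹) := by
  have hz : ∀ z : G, orderOf z = p → IsPGroup p (Subgroup.zpowers z) := fun z hz =>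
    IsPGroup.of_card (n := 1) (by rw [Nat.card_zpowers, hz, pow_one])
  obtain ⟨P, hP⟩ := (hz x hx).exists_le_sylow
  obtain ⟨Q, hQ⟩ := (hz y hy).exists_le_sylow
  obtain ⟨g, rfl⟩ := MulAction.exists_smul_eq G Q P
  refine ⟨g, ?_⟩
  have hxP : x ∈ ((g • Q : Sylow p G) : Subgroup G) := hP (Subgroup.mem_zpowers x)
  have hyP : g * y * g⁻¹ ∈ ((g • Q : Sylow p G) : Subgroup G) := by
    rw [Sylow.coe_subgroup_smul]
    exact Subgroup.smul_mem_pointwise_smul y (MulAut.conj g) _ (hQ (Subgroup.mem_zpowers y))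
  generalize g • Q = P at hxP hyP
  obtain ⟨n, hn⟩ := IsPGroup.iff_card.1 P.isPGroup'
  have hn3 : n < 3 := by
    by_contra! hcon
    exact h ((pow_dvd_pow p hcon).trans (hn ▸ Subgroup.card_subgroup_dvd_card _))
  have hcomm : IsMulCommutative (P : Subgroup G) := by
    interval_cases n
    · have : Subsingleton (P : Subgroup G) := (Nat.card_eq_one_iff_unique.1 (by simpa using hn)).1
      exact ⟨⟨fun a b => Subsingleton.elim _ _⟩⟩
    · have : IsCyclic (P : Subgroup G) := isCyclic_of_prime_card (p := p) (by simpa using hn)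
      exact IsCyclic.isMulCommutative
    · exact IsPGroup.isMulCommutative_of_card_eq_prime_sq hn
  exact congrArg Subtype.val (hcomm.is_comm.comm (⟨x, hxP⟩ : (P : Subgroup G)) ⟨_, hyP⟩)

lemma Nat.Prime.not_cube_dvd_factorial_two_mul {p : ℕ} (hp : p.Prime) (hodd : Odd p) :
    ¬ p ^ 3 ∣ (2 * p).factorial := by
  have h2 : ¬ p ∣ (2).factorial := by
    rw [hp.dvd_factorial]
    have := hp.two_le
    rintro h
    obtain rfl : p = 2 := by omega
    exact absurd hodd (by decide)
  rw [pow_dvd_iff_le_emultiplicity, mul_comm, hp.emultiplicity_factorial_mul,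
    emultiplicity_eq_zero.2 h2]
  norm_num

/-- The group of permutations of `G` which are automorphisms of `Cay(G, S)`. -/
def cayleyAut {G : Type*} [Group G] (S : Set G) : Subgroup (Equiv.Perm G) where
  carrier := {σ | ∀ g h, σ h * (σ g)⁻¹ ∈ S ↔ h * g⁻¹ ∈ S}
  one_mem' _ _ := Iff.rfl
  mul_mem' hσ hτ g h := (hσ _ _).trans (hτ _ _)
  inv_mem' {σ} hσ g h := by simpa using (hσ (σ⁻¹ g) (σ⁻¹ h)).symm

lemma mulRight_mem_cayleyAut {G : Type*} [Group G] (S : Set G) (x : G) :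
    Equiv.mulRight x ∈ cayleyAut S := fun g h => by simp

/-! ### Isomorphisms of dihedral Cayley digraphs -/

namespace DihedralGroup

variable {p : ℕ}

/-- The permutation `g ↦ g * r 1`. -/
def shift (p : ℕ) : Equiv.Perm (DihedralGroup p) := Equiv.mulRight (r 1)

@[simp] lemma shift_r (x : ZMod p) : shift p (r x) = r (x + 1) := by simp [shift]

@[simp] lemma shift_sr (x : ZMod p) : shift p (sr x) = sr (x + 1) := by simp [shift]

lemma shift_pow_r (n : ℕ) (x : ZMod p) : (shift p ^ n) (r x) = r (x + (n : ZMod p)) := by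
  induction n with
  | zero => simp
  | succ n ih => rw [pow_succ', Equiv.Perm.mul_apply, ih, shift_r]; push_cast; ring_nf

lemma shift_pow_sr (n : ℕ) (x : ZMod p) : (shift p ^ n) (sr x) = sr (x + (n : ZMod p)) := by
  induction n with
  | zero => simp
  | succ n ih => rw [pow_succ', Equiv.Perm.mul_apply, ih, shift_sr]; push_cast; ring_nf

lemma shift_ne [Fact p.Prime] (g : DihedralGroup p) : shift p g ≠ g := by
  cases g <;> simp

lemma orderOf_shift [Fact p.Prime] : orderOf (shift p) = p := by
  refine orderOf_eq_prime ?_ fun h => shift_ne (p := p) 1 (by rw [h]; rfl)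
  ext g
  cases g <;> simp [shift_pow_r, shift_pow_sr]

/-- Rotations centralize `r 1` and reflections invert it, so normalizing an isomorphism to fix `1`
keeps the commutation with the shift. -/
lemma mulRight_conj_shift (g : DihedralGroup p) :
    (Equiv.mulRight g)⁻¹ * shift p * Equiv.mulRight g = shift p ∨
      (Equiv.mulRight g)⁻¹ * shift p * Equiv.mulRight g = (shift p)⁻¹ := by
  have key (x : DihedralGroup p) : ((Equiv.mulRight g)⁻¹ * shift p * Equiv.mulRight g) x =
      x * (g * r 1 * g⁻¹) := by
    simp [shift, mul_assoc, Equiv.Perm.inv_def]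
  rcases g with i | i
  · left
    ext x
    rw [key]
    simp [shift]
  · right
    ext x
    rw [key]
    simp [shift, Equiv.Perm.inv_def]

/-- A permutation of odd order commuting with the shift is a translation on each of the cosets of
the rotation group. -/
lemma exists_translation_of_commute_shift [Fact p.Prime] (hodd : Odd p)
    {y : Equiv.Perm (DihedralGroup p)} (hy : y ^ p = 1) (hc : Commute (shift p) y) :
    ∃ k l : ZMod p, (∀ x, y (r x) = r (x + k)) ∧ ∀ x, y (sr x) = sr (x + l) := by
  have hn (n : ℕ) (g) : y ((shift p ^ n) g) = (shift p ^ n) (y g) :=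
    (congrArg (· g) (hc.pow_left n).eq).symm
  have hr (x : ZMod p) : y (r x) = (shift p ^ x.val) (y (r 0)) := by
    rw [← hn, shift_pow_r]; simp
  have hs (x : ZMod p) : y (sr x) = (shift p ^ x.val) (y (sr 0)) := by
    rw [← hn, shift_pow_sr]; simp
  rcases h0 : y (r 0) with k | k <;> rcases h1 : y (sr 0) with l | l
  · have h2 := hs (k - l)
    rw [h1, shift_pow_r] at h2
    cases y.injective (h2.trans (by simpa using h0.symm))
  · refine ⟨k, l, fun x => ?_, fun x => ?_⟩
    · rw [hr, h0, shift_pow_r]; simp [add_comm]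
    · rw [hs, h1, shift_pow_sr]; simp [add_comm]
  -- Here `y` swaps the two cosets, so its even powers preserve them and the odd power `y ^ p = 1`
  -- would swap them.
  · exfalso
    obtain ⟨m, rfl⟩ := hodd
    have h2 (n : ℕ) : ∃ t, (y ^ (2 * n)) (r 0) = r t := by
      induction n with
      | zero => exact ⟨0, by simp⟩
      | succ n ih =>
        obtain ⟨t, ht⟩ := ih
        rw [show 2 * (n + 1) = 2 + 2 * n by ring, pow_add, Equiv.Perm.mul_apply, ht, pow_two,
          Equiv.Perm.mul_apply, hr, h0, shift_pow_sr, hs, h1, shift_pow_r]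
        exact ⟨_, rfl⟩
    obtain ⟨t, ht⟩ := h2 m
    have := congrArg (· (r 0)) hy
    simp only [pow_succ', Equiv.Perm.mul_apply, ht, Equiv.Perm.one_apply] at this
    rw [hr, h0, shift_pow_sr] at this
    cases this
  · have h2 := hs (k - l)
    rw [h1, shift_pow_sr] at h2
    cases y.injective (h2.trans (by simpa using h0.symm))

/-- A permutation fixing `1` that conjugates the shift into its centralizer is affine on each of
the cosets of the rotation group. -/
lemma exists_affine_of_commute_shift [Fact p.Prime] (hodd : Odd p)
    {f : Equiv.Perm (DihedralGroup p)} (hf : f 1 = 1)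
    (hc : Commute (shift p) (f⁻¹ * shift p * f)) :
    ∃ u v : (ZMod p)ˣ, ∃ c : ZMod p, (∀ x, f (r x) = r ((u : ZMod p) * x)) ∧
      ∀ x, f (sr x) = sr ((v : ZMod p) * x + c) := by
  have hpow : (f⁻¹ * shift p * f) ^ p = 1 := by
    have := conj_pow (i := p) (a := f⁻¹) (b := shift p)
    rw [inv_inv] at this
    rw [this, orderOf_dvd_iff_pow_eq_one.1 orderOf_shift.dvd]
    simp
  obtain ⟨k, l, hk, hl⟩ := exists_translation_of_commute_shift hodd hpow hc
  -- `f` turns translation by `k` (resp. `l`) into translation by `1`, whence the slopes `k⁻¹` and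
  -- `l⁻¹`.
  have hk' (x : ZMod p) : f (r (x + k)) = shift p (f (r x)) := by rw [← hk]; simp
  have hl' (x : ZMod p) : f (sr (x + l)) = shift p (f (sr x)) := by rw [← hl]; simp
  have hk0 : k ≠ 0 := by
    rintro rfl
    exact shift_ne _ (by simpa using (hk' 0).symm)
  have hl0 : l ≠ 0 := by
    rintro rfl
    exact shift_ne _ (by simpa using (hl' 0).symm)
  have hkn (n : ℕ) : f (r (n * k)) = r n := by
    induction n with
    | zero => simpa using hf
    | succ n ih => push_cast; rw [add_mul, one_mul, hk', ih, shift_r]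
  have hkx (x : ZMod p) : f (r x) = r (k⁻¹ * x) := by
    have := hkn (k⁻¹ * x).val
    rw [ZMod.natCast_zmod_val] at this
    rw [← this]
    congr 2
    field_simp
  obtain ⟨c, hc⟩ : ∃ c, f (sr 0) = sr c := by
    rcases h : f (sr 0) with c | c
    · have h2 := hkx (k * c)
      rw [inv_mul_cancel_left₀ hk0, ← h] at h2
      simpa using f.injective h2
    · exact ⟨c, rfl⟩
  have hln (n : ℕ) : f (sr ((n : ZMod p) * l)) = sr ((n : ZMod p) + c) := by
    induction n with
    | zero => simpa using hc
    | succ n ih => push_cast; rw [add_mul, one_mul, hl', ih, shift_sr]; ring_nf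
  refine ⟨(Units.mk0 k hk0)⁻¹, (Units.mk0 l hl0)⁻¹, c, fun x => by simpa using hkx x, fun x => ?_⟩
  have := hln (l⁻¹ * x).val
  rw [ZMod.natCast_zmod_val] at this
  simp only [Units.val_inv_eq_inv_val, Units.val_mk0]
  rw [← this]
  congr 2
  field_simp

/-- Babai's theorem: isomorphic Cayley digraphs of the dihedral group of order `2 * p` have
connection sets that correspond under an automorphism of the group. -/
theorem exists_affine_of_cayley_iso [Fact p.Prime] (hodd : Odd p) {S T : Set (DihedralGroup p)}
    (f : Equiv.Perm (DihedralGroup p)) (hf : ∀ g h, f h * (f g)⁻¹ ∈ T ↔ h * g⁻¹ ∈ S) :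
    ∃ (u : (ZMod p)ˣ) (c : ZMod p), (∀ x, r ((u : ZMod p) * x) ∈ T ↔ r x ∈ S) ∧
      ∀ x, sr ((u : ZMod p) * x + c) ∈ T ↔ sr x ∈ S := by
  have hcard : ¬ p ^ 3 ∣ Nat.card (cayleyAut S) := by
    intro h
    refine (Fact.out : p.Prime).not_cube_dvd_factorial_two_mul hodd (h.trans ?_)
    have := Subgroup.card_subgroup_dvd_card (cayleyAut S)
    rwa [Nat.card_perm, DihedralGroup.nat_card] at this
  have hyS : f⁻¹ * shift p * f ∈ cayleyAut S := by
    intro g h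
    simp only [Equiv.Perm.mul_apply]
    rw [← hf, ← hf]
    simpa [shift] using mulRight_mem_cayleyAut T (r 1) (f g) (f h)
  have hxo : orderOf (⟨shift p, mulRight_mem_cayleyAut S (r 1)⟩ : cayleyAut S) = p := by
    rw [← Subgroup.orderOf_coe]; exact orderOf_shift
  have hyo : orderOf (⟨_, hyS⟩ : cayleyAut S) = p := by
    rw [← Subgroup.orderOf_coe]
    have : f⁻¹ * shift p * f = MulAut.conj f⁻¹ (shift p) := by simp
    simp only
    rw [this, MulEquiv.orderOf_eq]
    exact orderOf_shift
  obtain ⟨⟨a, ha⟩, hcomm⟩ := exists_commute_conj_of_not_dvd hcard hxo hyo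
  replace hcomm : Commute (shift p) (a * (f⁻¹ * shift p * f) * a⁻¹) := congrArg Subtype.val hcomm
  set b := f (a⁻¹ 1) with hb
  let e : Equiv.Perm (DihedralGroup p) := Equiv.mulRight b⁻¹ * f * a⁻¹
  have he1 : e 1 = 1 := by simp [e, hb]
  have heST (g h) : e h * (e g)⁻¹ ∈ T ↔ h * g⁻¹ ∈ S := by
    rw [← (cayleyAut S).inv_mem ha g h, ← hf]
    exact mulRight_mem_cayleyAut T b⁻¹ _ _
  have heshift : Commute (shift p) (e⁻¹ * shift p * e) := by
    have h1 : e⁻¹ * shift p * e = a * (f⁻¹ * ((Equiv.mulRight b⁻¹)⁻¹ * shift p *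
        Equiv.mulRight b⁻¹) * f) * a⁻¹ := by simp only [e]; group
    rw [h1]
    rcases mulRight_conj_shift b⁻¹ with h | h <;> rw [h]
    · exact hcomm
    · have : a * (f⁻¹ * (shift p)⁻¹ * f) * a⁻¹ = (a * (f⁻¹ * shift p * f) * a⁻¹)⁻¹ := by group
      rw [this]
      exact hcomm.inv_right
  obtain ⟨u, v, c, hu, hv⟩ := exists_affine_of_commute_shift hodd he1 heshift
  have hS (h) : e h ∈ T ↔ h ∈ S := by simpa [he1] using heST 1 h
  have hrot (x : ZMod p) : r ((u : ZMod p) * x) ∈ T ↔ r x ∈ S := by rw [← hS, hu]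
  by_cases huv : u = v
  · exact ⟨u, c, hrot, fun x => by rw [← hS, hv, huv]⟩
  -- With distinct slopes, the arcs from `r t` to `sr (x + t)` have images whose quotients run over
  -- all reflections as `t` varies. The chosen `t` gives `sr (u * x)`, so `c = 0` works.
  · have huv' : (v : ZMod p) - u ≠ 0 := sub_ne_zero.2 fun h => huv (Units.ext h.symm)
    refine ⟨u, 0, hrot, fun x => ?_⟩
    have := heST (r ((v - u : ZMod p)⁻¹ * (u * x - v * x - c)))
      (sr (x + (v - u : ZMod p)⁻¹ * (u * x - v * x - c)))
    rw [hu, hv, inv_r, inv_r, sr_mul_r, sr_mul_r] at this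
    rw [← show x + (v - u : ZMod p)⁻¹ * (u * x - v * x - c) +
      -((v - u : ZMod p)⁻¹ * (u * x - v * x - c)) = x by ring, ← this]
    rw [iff_iff_eq]
    congr 2
    field_simp
    ring

/-! ### The affine group and its orbits on connection sets -/

/-- The affine group of the line over `ZMod p`: the pair `(u, c)` stands for `x ↦ u * x + c`. -/
@[ext] structure Aff (p : ℕ) where
  unit : (ZMod p)ˣ
  const : ZMod p

namespace Aff

instance : Group (Aff p) where
  mul a b := ⟨a.unit * b.unit, a.unit * b.const + a.const⟩
  one := ⟨1, 0⟩
  inv a := ⟨a.unit⁻¹, -(a.unit⁻¹.val * a.const)⟩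
  mul_assoc a b c := Aff.ext (mul_assoc _ _ _) (by
    change ((a.unit * b.unit : (ZMod p)ˣ) : ZMod p) * c.const + (a.unit * b.const + a.const) =
      a.unit * (b.unit * c.const + b.const) + a.const
    push_cast; ring)
  one_mul a := Aff.ext (one_mul _) (by
    change ((1 : (ZMod p)ˣ) : ZMod p) * a.const + 0 = a.const
    simp)
  mul_one a := Aff.ext (mul_one _) (by
    change (a.unit : ZMod p) * 0 + a.const = a.const
    simp)
  inv_mul_cancel a := Aff.ext (inv_mul_cancel _) (by
    change (a.unit⁻¹.val : ZMod p) * a.const + -(a.unit⁻¹.val * a.const) = 0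
    simp)

lemma mul_def (a b : Aff p) : a * b = ⟨a.unit * b.unit, a.unit * b.const + a.const⟩ := rfl

instance : MulAction (Aff p) (ZMod p) where
  smul a x := a.unit * x + a.const
  one_smul x := by
    change ((1 : (ZMod p)ˣ) : ZMod p) * x + 0 = x
    simp
  mul_smul a b x := by
    change ((a.unit * b.unit : (ZMod p)ˣ) : ZMod p) * x + (a.unit * b.const + a.const) =
      a.unit * (b.unit * x + b.const) + a.const
    push_cast; ring

lemma smul_def (a : Aff p) (x : ZMod p) : a • x = a.unit * x + a.const := rfl

instance : MulAction (Aff p) (ZMod p)ˣ where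
  smul a x := a.unit * x
  one_smul x := one_mul x
  mul_smul _ _ x := mul_assoc _ _ x

lemma smul_unit_def (a : Aff p) (x : (ZMod p)ˣ) : a • x = a.unit * x := rfl

/-- The affine group as the type of pairs of a linear part and a constant term. -/
def equivProd (p : ℕ) : Aff p ≃ (ZMod p)ˣ × ZMod p where
  toFun a := (a.unit, a.const)
  invFun a := ⟨a.1, a.2⟩

instance [NeZero p] : Fintype (Aff p) := Fintype.ofEquiv _ (equivProd p).symm

end Aff

/-- The subset of the dihedral group with rotations `r a`, `a ∈ X.1`, and reflections `sr b`,
`b ∈ X.2`. -/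
def connectionSet (X : Set (ZMod p)ˣ × Set (ZMod p)) : Set (DihedralGroup p) :=
  {g | (∃ a ∈ X.1, r (a : ZMod p) = g) ∨ ∃ b ∈ X.2, sr b = g}

@[simp] lemma r_mem_connectionSet {X : Set (ZMod p)ˣ × Set (ZMod p)} {x : ZMod p} :
    r x ∈ connectionSet X ↔ ∃ a ∈ X.1, (a : ZMod p) = x := by
  simp [connectionSet]

@[simp] lemma sr_mem_connectionSet {X : Set (ZMod p)ˣ × Set (ZMod p)} {x : ZMod p} :
    sr x ∈ connectionSet X ↔ x ∈ X.2 := by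
  simp [connectionSet]

lemma r_unit_mem_connectionSet {X : Set (ZMod p)ˣ × Set (ZMod p)} {x : (ZMod p)ˣ} :
    r (x : ZMod p) ∈ connectionSet X ↔ x ∈ X.1 := by
  simp [Units.val_inj]

lemma one_notMem_connectionSet [Fact p.Prime] (X : Set (ZMod p)ˣ × Set (ZMod p)) :
    1 ∉ connectionSet X := by
  rw [one_def, r_mem_connectionSet]
  rintro ⟨a, -, h⟩
  exact a.ne_zero h

/-- The Cayley digraph with connection set `connectionSet X`. -/
def toCayley [Fact p.Prime] (X : Set (ZMod p)ˣ × Set (ZMod p)) :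
    {Γ : Digraph (DihedralGroup p) // IsCayleyDigraph Γ} :=
  ⟨cayleyDigraph (connectionSet X), _, one_notMem_connectionSet X, rfl⟩

lemma toCayley_bijective [Fact p.Prime] : Function.Bijective (toCayley (p := p)) := by
  constructor
  · intro X Y h
    have h1 : ∀ g, g ∈ connectionSet X ↔ g ∈ connectionSet Y := fun g => by
      have := congrArg (fun Γ => Γ.1.Adj 1 g) h
      simpa [toCayley, cayleyDigraph] using this
    refine Prod.ext (Set.ext fun x => ?_) (Set.ext fun x => ?_)
    · rw [← r_unit_mem_connectionSet, h1, r_unit_mem_connectionSet]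
    · rw [← sr_mem_connectionSet, h1, sr_mem_connectionSet]
  · rintro ⟨Γ, S, hS, rfl⟩
    refine ⟨({a | r (a : ZMod p) ∈ S}, {b | sr b ∈ S}), Subtype.ext ?_⟩
    refine congrArg cayleyDigraph (Set.ext ?_)
    rintro (x | x)
    · by_cases hx : x = 0
      · subst hx
        exact iff_of_false (one_notMem_connectionSet _) hS
      · exact r_unit_mem_connectionSet (x := Units.mk0 x hx)
    · simp

lemma isomorphic_toCayley_iff [Fact p.Prime] (hodd : Odd p)
    (X Y : Set (ZMod p)ˣ × Set (ZMod p)) :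
    DigraphIsomorphic (toCayley X).1 (toCayley Y).1 ↔ MulAction.orbitRel (Aff p) _ X Y := by
  -- The swap makes the group element carry `X` to `Y`, as `f` does.
  rw [Setoid.comm', MulAction.orbitRel_apply]
  constructor
  · rintro ⟨f⟩
    obtain ⟨u, c, hr, hs⟩ := exists_affine_of_cayley_iso hodd f.toEquiv
      (S := connectionSet X) (T := connectionSet Y) fun g h => f.map_rel_iff (a := g) (b := h)
    let a : Aff p := ⟨u, c⟩
    refine ⟨a, Prod.ext (Set.ext fun x => ?_) (Set.ext fun x => ?_)⟩
    · obtain ⟨x, rfl⟩ := MulAction.surjective a x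
      change a • x ∈ a • X.1 ↔ a • x ∈ Y.1
      rw [Set.smul_mem_smul_set_iff, ← r_unit_mem_connectionSet, ← hr,
        ← r_unit_mem_connectionSet, Aff.smul_unit_def, Units.val_mul]
    · obtain ⟨x, rfl⟩ := MulAction.surjective a x
      change a • x ∈ a • X.2 ↔ a • x ∈ Y.2
      rw [Set.smul_mem_smul_set_iff, ← sr_mem_connectionSet, ← hs, ← sr_mem_connectionSet,
        Aff.smul_def]
  · rintro ⟨a, rfl⟩
    have hr (x : ZMod p) : r ((a.unit : ZMod p) * x) ∈ connectionSet (a • X) ↔ r x ∈ connectionSet X := by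
      by_cases hx : x = 0
      · subst hx
        rw [mul_zero]
        exact iff_of_false (one_notMem_connectionSet _) (one_notMem_connectionSet _)
      · lift x to (ZMod p)ˣ using isUnit_iff_ne_zero.2 hx
        rw [← Units.val_mul, r_unit_mem_connectionSet, r_unit_mem_connectionSet,
          ← Aff.smul_unit_def]
        exact Set.smul_mem_smul_set_iff
    have hs (x : ZMod p) : sr ((a.unit : ZMod p) * x + a.const) ∈ connectionSet (a • X) ↔
        sr x ∈ connectionSet X := by
      rw [sr_mem_connectionSet, sr_mem_connectionSet, ← Aff.smul_def]
      exact Set.smul_mem_smul_set_iff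
    let φ : DihedralGroup p → DihedralGroup p
      | r x => r ((a.unit : ZMod p) * x)
      | sr x => sr ((a.unit : ZMod p) * x + a.const)
    have hφ : Function.Injective φ := by
      rintro (x | x) (y | y) h <;> simp [φ] at h ⊢ <;> exact h
    have : Finite (DihedralGroup p) := inferInstance
    refine ⟨⟨Equiv.ofBijective φ (Finite.injective_iff_bijective.1 hφ), ?_⟩⟩
    rintro (x | x) (y | y)
    · simpa [toCayley, cayleyDigraph, φ, mul_sub, ← sub_eq_add_neg] using hr (y - x)
    · change sr _ * (r _)⁻¹ ∈ _ ↔ sr _ * (r _)⁻¹ ∈ _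
      rw [inv_r, inv_r, sr_mul_r, sr_mul_r, ← hs]
      ring_nf
    · change r _ * (sr _)⁻¹ ∈ _ ↔ r _ * (sr _)⁻¹ ∈ _
      rw [inv_sr, inv_sr, r_mul_sr, r_mul_sr, ← hs]
      ring_nf
    · change sr _ * (sr _)⁻¹ ∈ _ ↔ sr _ * (sr _)⁻¹ ∈ _
      rw [inv_sr, inv_sr, sr_mul_sr, sr_mul_sr, ← hr]
      ring_nf

lemma numCayleyDigraphs_eq [Fact p.Prime] (hodd : Odd p) :
    numCayleyDigraphs (DihedralGroup p) =
      Nat.card (MulAction.orbitRel.Quotient (Aff p) (Set (ZMod p)ˣ × Set (ZMod p))) :=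
  (Nat.card_congr (Quotient.congr (Equiv.ofBijective _ toCayley_bijective)
    fun X Y => (isomorphic_toCayley_iff hodd X Y).symm)).symm

/-! ### Fixed-point counts and Burnside's lemma -/

lemma smul_set_eq_self_iff {G α : Type*} [Group G] [MulAction G α] (g : G) (B : Set α) :
    g • B = B ↔ ∀ x, g • x ∈ B ↔ x ∈ B := by
  constructor
  · intro hB x
    conv_lhs => rw [← hB]
    exact Set.smul_mem_smul_set_iff
  · intro hB
    ext y
    rw [Set.mem_smul_set_iff_inv_smul_mem, ← hB, smul_inv_smul]

/-- The number of subsets of a finite commutative group invariant under multiplication by `g`. -/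
lemma card_smul_eq_self {G : Type*} [CommGroup G] [Finite G] (g : G) :
    Nat.card {A : Set G // g • A = A} = 2 ^ (Nat.card G / orderOf g) := by
  classical
  let H := Subgroup.zpowers g
  -- The invariant sets are the unions of cosets of `⟨g⟩`.
  have hrange : {A : Set G | g • A = A} =
      Set.range (Set.preimage (QuotientGroup.mk : G → G ⧸ H)) := by
    ext A
    constructor
    · intro hA
      have hA' : H ≤ MulAction.stabilizer G A := by
        rw [Subgroup.zpowers_le]; exact hA
      refine ⟨QuotientGroup.mk '' A, Set.ext fun x => ⟨?_, fun hx => ⟨x, hx, rfl⟩⟩⟩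
      rintro ⟨y, hy, hxy⟩
      have h1 : (y⁻¹ * x) • A = A := hA' (QuotientGroup.eq.1 hxy)
      rw [← h1]
      exact ⟨y, hy, by simp⟩
    · rintro ⟨B, rfl⟩
      refine Set.ext fun x => ?_
      rw [Set.mem_smul_set_iff_inv_smul_mem]
      have : (QuotientGroup.mk (g⁻¹ • x) : G ⧸ H) = QuotientGroup.mk x :=
        QuotientGroup.eq.2 (by simp [H])
      simp only [Set.mem_preimage, this]
  have h2 : Nat.card {A : Set G | g • A = A} = Nat.card (Set (G ⧸ H)) := by
    rw [hrange]
    exact Nat.card_congr (Equiv.ofInjective _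
      (Set.preimage_injective.2 QuotientGroup.mk_surjective)).symm
  have h3 : Nat.card G / orderOf g = Nat.card (G ⧸ H) := by
    rw [Subgroup.card_eq_card_quotient_mul_card_subgroup H, Nat.card_zpowers,
      Nat.mul_div_cancel _ (orderOf_pos g)]
  have : Fintype (G ⧸ H) := Fintype.ofFinite _
  rw [h3]
  refine h2.trans ?_
  rw [Nat.card_eq_fintype_card, Fintype.card_set, Nat.card_eq_fintype_card]

lemma card_units_zmod [Fact p.Prime] : Nat.card (ZMod p)ˣ = p - 1 := by
  rw [Nat.card_eq_fintype_card, ZMod.card_units]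

lemma card_fixedBy_units [Fact p.Prime] (a : Aff p) :
    Nat.card (MulAction.fixedBy (Set (ZMod p)ˣ) a) = 2 ^ ((p - 1) / orderOf a.unit) := by
  rw [← card_units_zmod, ← card_smul_eq_self]
  rfl

lemma card_fixedBy_one [Fact p.Prime] :
    Nat.card (MulAction.fixedBy (Set (ZMod p)) (1 : Aff p)) = 2 ^ p := by
  rw [MulAction.fixedBy_one_eq_univ, Nat.card_univ, Nat.card_eq_fintype_card, Fintype.card_set,
    ZMod.card]

/-- A nonzero `c` generates `ZMod p`, so translation by it is transitive. -/
lemma card_fixedBy_translation [Fact p.Prime] {c : ZMod p} (hc : c ≠ 0) :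
    Nat.card (MulAction.fixedBy (Set (ZMod p)) (⟨1, c⟩ : Aff p)) = 2 := by
  have : MulAction.fixedBy (Set (ZMod p)) (⟨1, c⟩ : Aff p) = {∅, Set.univ} := by
    ext B
    simp only [MulAction.mem_fixedBy, Set.mem_insert_iff, Set.mem_singleton_iff]
    constructor
    · intro h
      have hadd (x : ZMod p) : x + c ∈ B ↔ x ∈ B := by
        simpa [Aff.smul_def] using (smul_set_eq_self_iff _ B).1 h x
      have hn (n : ℕ) (x : ZMod p) : x + n * c ∈ B ↔ x ∈ B := by
        induction n with
        | zero => simp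
        | succ n ih => rw [← ih, ← hadd (x + n * c)]; push_cast; ring_nf
      rcases B.eq_empty_or_nonempty with h0 | ⟨b, hb⟩
      · exact Or.inl h0
      · refine Or.inr (Set.eq_univ_of_forall fun x => ?_)
        have := (hn ((x - b) / c).val b).2 hb
        rw [ZMod.natCast_zmod_val, div_mul_cancel₀ _ hc] at this
        simpa using this
    · rintro (rfl | rfl)
      · exact Set.smul_set_empty
      · exact Set.smul_set_univ
  rw [this, Nat.card_coe_set_eq, Set.ncard_pair Set.empty_ne_univ]

/-- The factor `2` records whether the fixed point `0` belongs to the set. -/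
lemma card_fixedBy_linear [Fact p.Prime] (u : (ZMod p)ˣ) :
    Nat.card (MulAction.fixedBy (Set (ZMod p)) (⟨u, 0⟩ : Aff p)) =
      2 * 2 ^ ((p - 1) / orderOf u) := by
  classical
  have hmem (B : Set (ZMod p)) : (⟨u, 0⟩ : Aff p) • B = B ↔
      ∀ x, (u : ZMod p) * x ∈ B ↔ x ∈ B := by
    simp [smul_set_eq_self_iff, Aff.smul_def]
  have hmem' (A : Set (ZMod p)ˣ) : u • A = A ↔ ∀ x, u * x ∈ A ↔ x ∈ A :=
    smul_set_eq_self_iff u A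
  let e : MulAction.fixedBy (Set (ZMod p)) (⟨u, 0⟩ : Aff p) ≃
      Prop × {A : Set (ZMod p)ˣ // u • A = A} :=
    { toFun B := ((0 : ZMod p) ∈ B.1, ⟨{x | (x : ZMod p) ∈ B.1}, (hmem' _).2 fun x => by
        simpa using (hmem B.1).1 B.2 x⟩)
      invFun P := ⟨{x | (x = 0 ∧ P.1) ∨ ∃ y ∈ P.2.1, (y : ZMod p) = x}, (hmem _).2 fun x => by
        by_cases hx : x = 0
        · simp [hx]
        · lift x to (ZMod p)ˣ using isUnit_iff_ne_zero.2 hx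
          have := (hmem' _).1 P.2.2 x
          simpa [← Units.val_mul, Units.val_inj] using this⟩
      left_inv B := by
        refine Subtype.ext (Set.ext fun x => ?_)
        by_cases hx : x = 0
        · simp [hx]
        · lift x to (ZMod p)ˣ using isUnit_iff_ne_zero.2 hx
          simp [Units.val_inj]
      right_inv P := by
        refine Prod.ext ?_ (Subtype.ext (Set.ext fun x => ?_))
        · simp
        · simp [Units.val_inj] }
  rw [Nat.card_congr e, Nat.card_prod, card_smul_eq_self, card_units_zmod]
  simp

/-- The map has the fixed point `c / (1 - u)`; translating it to `0` conjugates the map to its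
linear part. -/
lemma card_fixedBy_of_unit_ne_one [Fact p.Prime] {u : (ZMod p)ˣ} (hu : u ≠ 1) (c : ZMod p) :
    Nat.card (MulAction.fixedBy (Set (ZMod p)) (⟨u, c⟩ : Aff p)) =
      2 * 2 ^ ((p - 1) / orderOf u) := by
  have hu' : (1 : ZMod p) - u ≠ 0 := sub_ne_zero.2 fun h => hu (Units.ext h.symm)
  have h : (⟨u, c⟩ : Aff p) = ⟨1, (1 - u : ZMod p)⁻¹ * c⟩ * ⟨u, 0⟩ *
      (⟨1, (1 - u : ZMod p)⁻¹ * c⟩)⁻¹ := by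
    rw [eq_mul_inv_iff_mul_eq, Aff.mul_def, Aff.mul_def]
    ext
    · simp
    · simp
      field_simp
      ring
  rw [h, ← MulAction.smul_fixedBy, ← card_fixedBy_linear]
  exact Nat.card_image_of_injective (MulAction.injective _) _

lemma card_fixedBy [Fact p.Prime] (u : (ZMod p)ˣ) (c : ZMod p) :
    Nat.card (MulAction.fixedBy (Set (ZMod p)ˣ × Set (ZMod p)) (⟨u, c⟩ : Aff p)) =
      Nat.card (MulAction.fixedBy (Set (ZMod p)) (⟨u, c⟩ : Aff p)) * 2 ^ ((p - 1) / orderOf u) := by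
  rw [mul_comm, ← card_fixedBy_units ⟨u, c⟩, ← Nat.card_prod]
  exact Nat.card_congr
    { toFun X := (⟨X.1.1, congrArg Prod.fst X.2⟩, ⟨X.1.2, congrArg Prod.snd X.2⟩)
      invFun X := ⟨(X.1.1, X.2.1), Prod.ext X.1.2 X.2.2⟩ }

lemma sum_card_fixedBy_one [Fact p.Prime] :
    ∑ c : ZMod p,
      Nat.card (MulAction.fixedBy (Set (ZMod p)ˣ × Set (ZMod p)) (⟨1, c⟩ : Aff p)) =
      (2 ^ p + 2 * (p - 1)) * 2 ^ (p - 1) := by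
  simp_rw [card_fixedBy, orderOf_one, Nat.div_one, ← Finset.sum_mul]
  congr 1
  rw [← Finset.add_sum_erase _ _ (Finset.mem_univ 0)]
  congr 1
  · exact card_fixedBy_one
  · rw [Finset.sum_congr rfl fun c hc => card_fixedBy_translation (Finset.ne_of_mem_erase hc)]
    simp [ZMod.card, mul_comm]

lemma sum_card_fixedBy_of_unit_ne_one [Fact p.Prime] {u : (ZMod p)ˣ} (hu : u ≠ 1) :
    ∑ c : ZMod p,
      Nat.card (MulAction.fixedBy (Set (ZMod p)ˣ × Set (ZMod p)) (⟨u, c⟩ : Aff p)) =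
      p * (2 * 2 ^ (2 * (p - 1) / orderOf u)) := by
  have hd : orderOf u ∣ p - 1 := card_units_zmod (p := p) ▸ orderOf_dvd_natCard u
  simp_rw [card_fixedBy, card_fixedBy_of_unit_ne_one hu]
  rw [Finset.sum_const, Finset.card_univ, ZMod.card, smul_eq_mul, Nat.mul_div_assoc _ hd, mul_assoc 2,
    ← pow_add, ← two_mul]

lemma sum_orderOf_units [Fact p.Prime] (F : ℕ → ℕ) :
    ∑ u : (ZMod p)ˣ, F (orderOf u) = ∑ d ∈ (p - 1).divisors, d.totient * F d := by
  have hp := (Fact.out : p.Prime).two_le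
  rw [← Finset.sum_fiberwise_of_maps_to (t := (p - 1).divisors) (g := orderOf) fun u _ =>
    Nat.mem_divisors.2 ⟨card_units_zmod (p := p) ▸ orderOf_dvd_natCard u, by omega⟩]
  refine Finset.sum_congr rfl fun d hd => ?_
  rw [← IsCyclic.card_orderOf_eq_totient (α := (ZMod p)ˣ) (d := d)
    (by rw [ZMod.card_units]; exact Nat.dvd_of_mem_divisors hd), ← smul_eq_mul,
    ← Finset.sum_const]
  exact Finset.sum_congr rfl fun u hu => by rw [(Finset.mem_filter.1 hu).2]

/-- Burnside's count of the Cayley digraphs on the dihedral group of order `2 * p`. -/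
lemma numCayleyDigraphs_mul [Fact p.Prime] (hodd : Odd p) :
    numCayleyDigraphs (DihedralGroup p) * ((p - 1) * p) + p * (2 * 2 ^ (2 * (p - 1))) =
      (2 ^ p + 2 * (p - 1)) * 2 ^ (p - 1) +
        p * (2 * ∑ d ∈ (p - 1).divisors, d.totient * 2 ^ (2 * (p - 1) / d)) := by
  classical
  have hcard : Fintype.card (Aff p) = (p - 1) * p := by
    rw [Fintype.card_congr (Aff.equivProd p), Fintype.card_prod, ZMod.card_units, ZMod.card]
  have hburn := MulAction.sum_card_fixedBy_eq_card_orbits_mul_card_group (Aff p)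
    (Set (ZMod p)ˣ × Set (ZMod p))
  rw [hcard, ← Nat.card_eq_fintype_card, ← MulAction.orbitRel.Quotient,
    ← numCayleyDigraphs_eq hodd] at hburn
  simp_rw [← Nat.card_eq_fintype_card] at hburn
  -- The divisor sum includes a generic term for `u = 1`, which the true count lacks; it is added on
  -- the left to avoid subtraction in `ℕ`.
  rw [← hburn, ← (Aff.equivProd p).symm.sum_comp, Fintype.sum_prod_type,
    ← Finset.add_sum_erase _ _ (Finset.mem_univ 1), ← sum_orderOf_units,
    ← Finset.add_sum_erase Finset.univ (fun u : (ZMod p)ˣ => 2 ^ (2 * (p - 1) / orderOf u))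
      (Finset.mem_univ 1), orderOf_one, Nat.div_one]
  have h1 := sum_card_fixedBy_one (p := p)
  have h2 := Finset.sum_congr rfl fun u (hu : u ∈ Finset.univ.erase (1 : (ZMod p)ˣ)) =>
    sum_card_fixedBy_of_unit_ne_one (Finset.ne_of_mem_erase hu)
  rw [← Finset.mul_sum, ← Finset.mul_sum] at h2
  change ∑ c, _ + ∑ u ∈ _, ∑ c, _ + _ = _
  simp only [Aff.equivProd, Equiv.coe_fn_symm_mk]
  rw [h1, h2]
  ring

end DihedralGroup

theorem mainTheorem1 (p : ℕ) (hp : p.Prime) (hodd : Odd p) :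
    (numCayleyDigraphs (DihedralGroup p) : ℚ) =
      1 / (p : ℚ) * 2 ^ p * (1 - 2 ^ (p - 1)) +
        2 / ((p : ℚ) - 1) *
          ∑ d ∈ (p - 1).divisors, (Nat.totient d : ℚ) * 2 ^ (2 * (p - 1) / d) := by
  have : Fact p.Prime := ⟨hp⟩
  have h := congrArg (Nat.cast (R := ℚ)) (DihedralGroup.numCayleyDigraphs_mul hodd)
  obtain ⟨m, rfl⟩ : ∃ m, p = m + 1 := ⟨p - 1, (Nat.sub_add_cancel hp.pos).symm⟩
  have hm : (m : ℚ) ≠ 0 := by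
    have := hp.two_le
    exact_mod_cast (by omega : m ≠ 0)
  have hm1 : (m : ℚ) + 1 ≠ 0 := by positivity
  push_cast [Nat.add_sub_cancel] at h ⊢
  rw [add_sub_cancel_right]
  field_simp
  ring_nf at h ⊢
  linarith
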